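/- Let $\mathcal S$ be an (abstract) operator system with unit $e$: that is, $\mathcal S$ is a complex $*$-vector space, $\{M_n(\mathcal S)^+\}_{n\ge 1}$ is a matrix ordering on $\mathcal S$ (proper cones $M_n(\mathcal S)^+\subseteq M_n(\mathcal S)_{sa}$ with $X^*M_n(\mathcal S)^+X\subseteq M_m(\mathcal S)^+$ for every scalar matrix $X\in M_{n,m}(\mathbb C)$), and $e=e^*\in\mathcal S$ is an Archimedean matrix order unit (for every $n$, with $e_n=e\otimes I_n$: for every $v\in M_n(\mathcal S)_{sa}$ there is a real $t>0$ with $te_n-v\in M_n(\mathcal S)^+$; and $v\in M_n(\mathcal S)^+$ whenever $v\in M_n(\mathcal S)$ satisfies $te_n+v\in M_n(\mathcal S)^+$ for all real $t>0$). Fix an integer $k\ge 1$, and for $n\ge 1$ put $$D_n^{k\text{-}\max}(\mathcal S)=\{ADA^* : m\in\mathbb N,\ A\in M_{n,mk}(\mathbb C),\ D=\operatorname{diag}(D_1,\dots,D_m),\ D_l\in M_k(\mathcal S)^+\text{ for }1\le l\le m\},$$ $$C_n^{k\text{-}\max}(\mathcal S)=\{a\in M_n(\mathcal S) : re_n+a\in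 D_n^{k\text{-}\max}(\mathcal S)\text{ for all real } r>0\}.$$ Call a linear map $\phi:\mathcal S\to B(\mathcal H)$, where $\mathcal H$ is a complex Hilbert space, unital if $\phi(e)=I_{\mathcal H}$, and $k$-positive if $(\phi(v_{ij}))\in M_k(B(\mathcal H))^+$ for every $(v_{ij})\in M_k(\mathcal S)^+$; here $M_n(B(\mathcal H))^+$ is the set of $n\times n$ matrices of operators that define positive operators on $\mathcal H^n$. Then for every $n\ge 1$ and every $(a_{ij})\in M_n(\mathcal S)$: $(a_{ij})\in C_n^{k\text{-}\max}(\mathcal S)$ if and only if $(\phi(a_{ij}))\in M_n(B(\mathcal H))^+$ for every complex Hilbert space $\mathcal H$ and every unital $k$-positive map $\phi:\mathcal S\to B(\mathcal H)$. -/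

import Mathlib

open scoped Matrix

universe u v

namespace OpSys

noncomputable section

/-- A family of sets of square matrices over `V`, one for each matrix size. -/
abbrev MatrixCones (V : Type*) := (n : ℕ) → Set (Matrix (Fin n) (Fin n) V)

section Algebra

variable {V : Type*} [AddCommGroup V] [Module ℂ V]

/-- The product `A v B` of a matrix `v` over a complex vector space with scalar matrices `A`, `B`
on either side: its entries are `∑ i j, a_{pi} v_{ij} b_{jq}`. -/
def sandwich {m n p q : Type*} [Fintype m] [Fintype n]
    (A : Matrix p m ℂ) (v : Matrix m n V) (B : Matrix n q ℂ) : Matrix p q V :=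
  Matrix.of fun a b => ∑ i, ∑ j, (A a i * B j b) • v i j

/-- The matrix `e_n = e ⊗ I_n`. -/
def ampUnit (e : V) (n : ℕ) : Matrix (Fin n) (Fin n) V := Matrix.diagonal fun _ => e

/-- A proper cone in the self-adjoint part of the matrices over `V`: it consists of self-adjoint
matrices, contains `0`, is closed under sums and under multiplication by non-negative reals,
and meets its negative only in `0`. -/
structure IsProperCone [StarAddMonoid V] {n : ℕ} (C : Set (Matrix (Fin n) (Fin n) V)) : Prop where
  selfAdjoint : ∀ v ∈ C, vᴴ = v
  nonempty : C.Nonempty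
  add_mem : ∀ v ∈ C, ∀ w ∈ C, v + w ∈ C
  smul_mem : ∀ r : ℝ, 0 ≤ r → ∀ v ∈ C, (r : ℂ) • v ∈ C
  eq_zero : ∀ v ∈ C, -v ∈ C → v = 0

/-- A matrix ordering: a family of proper cones `C_n` with `X* C_n X ⊆ C_m` for every scalar
`n × m` matrix `X`. -/
structure IsMatrixOrdering [StarAddMonoid V] (C : MatrixCones V) : Prop where
  properCone : ∀ n, IsProperCone (C n)
  compatible : ∀ (n m : ℕ) (X : Matrix (Fin n) (Fin m) ℂ), ∀ v ∈ C n, sandwich Xᴴ v X ∈ C m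

/-- `(V, C, e)` is an (abstract) operator system: `V` is a complex `*`-vector space, `C` is a
matrix ordering and `e` is an Archimedean matrix order unit. -/
structure IsOperatorSystem [StarAddMonoid V] [StarModule ℂ V] (C : MatrixCones V) (e : V) :
    Prop where
  matrixOrdering : IsMatrixOrdering C
  unit_selfAdjoint : star e = e
  orderUnit : ∀ (n : ℕ) (v : Matrix (Fin n) (Fin n) V), vᴴ = v →
    ∃ t : ℝ, 0 < t ∧ (t : ℂ) • ampUnit e n - v ∈ C n
  archimedean : ∀ (n : ℕ) (v : Matrix (Fin n) (Fin n) V),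
    (∀ t : ℝ, 0 < t → (t : ℂ) • ampUnit e n + v ∈ C n) → v ∈ C n

/-- The cones `D_n^{k-max}`: all matrices `A D A*`, where `D = diag(D_1, …, D_m)` with every block
`D_l` in `C_k`, and `A` is a scalar `n × mk` matrix (its columns are indexed by pairs
`(position inside the block, block)`). -/
def kMaxD (C : MatrixCones V) (k : ℕ) : MatrixCones V := fun n =>
  {v | ∃ (m : ℕ) (A : Matrix (Fin n) (Fin k × Fin m) ℂ)
      (D : Fin m → Matrix (Fin k) (Fin k) V),
      (∀ l, D l ∈ C k) ∧ v = sandwich A (Matrix.blockDiagonal D) Aᴴ}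

/-- The super `k`-maximal cones `C_n^{k-max}`: all matrices `v` with `r e_n + v ∈ D_n^{k-max}` for
every real `r > 0`. -/
def kMax (C : MatrixCones V) (e : V) (k : ℕ) : MatrixCones V := fun n =>
  {v | ∀ r : ℝ, 0 < r → (r : ℂ) • ampUnit e n + v ∈ kMaxD C k n}

/-- `φ` is `k`-positive with respect to the matrix cones `C`, `C'` if its `k`-th amplification
maps `C_k` into `C'_k`. -/
def IsKPositive {W : Type*} [AddCommGroup W] [Module ℂ W] (C : MatrixCones V) (C' : MatrixCones W)
    (k : ℕ) (φ : V →ₗ[ℂ] W) : Prop :=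
  ∀ v ∈ C k, v.map φ ∈ C' k

end Algebra

section Hilbert

variable (H : Type*) [NormedAddCommGroup H] [InnerProductSpace ℂ H]

/-- The operator on the Hilbert space direct sum `H^n` given by a matrix of operators:
`(T x)_i = ∑ j, T_{ij} x_j`. -/
def matrixOperator {H} [NormedAddCommGroup H] [InnerProductSpace ℂ H] {n : ℕ}
    (T : Matrix (Fin n) (Fin n) (H →L[ℂ] H)) :
    PiLp 2 (fun _ : Fin n => H) →L[ℂ] PiLp 2 (fun _ : Fin n => H) :=
  (PiLp.continuousLinearEquiv 2 ℂ (fun _ : Fin n => H)).symm.toContinuousLinearMap ∘L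
    ContinuousLinearMap.pi fun i =>
      ∑ j, T i j ∘L (PiLp.proj 2 (fun _ : Fin n => H) j : PiLp 2 (fun _ : Fin n => H) →L[ℂ] H)

/-- The cones `M_n(B(H))^+`: matrices of operators that are positive as operators on `H^n`. -/
def opCones : MatrixCones (H →L[ℂ] H) := fun _ => {T | (matrixOperator T).IsPositive}

end Hilbert

end

end OpSys

/-! If `φ` is unital and `k`-positive, its quadratic form on `A D A*` at `x` is a sum of forms on
blocks `D_l ∈ C_k` at transformed vectors, hence non-negative; letting `r → 0` passes from
`D_n^{k-max}` to `C_n^{k-max}`.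

For the converse, let `a` be self-adjoint with `r e_n + a ∉ D_n^{k-max}` for some `r > 0`. Since
`e_n` is an order unit even for this smaller cone (`kMaxD_orderUnit`), Riesz extension yields a
functional `F ≥ 0` on the cone with `F e_n = 1` and `Re F(a) < 0` (`exists_functional`). The map `s
↦ (F (E_{ij} ⊗ s))` is `k`-positive, because its forms on `w ∈ C_k` are the values `F (X* w X)`. It
need not be unital, as its value at `e` may be singular. Adding `ε tr(·) 1` makes that value
positive definite, and a congruence then normalises it to `1`; for small `ε` the form at `a` stays
negative at a suitable vector.

A general `a` is `x + i y` with `x`, `y` self-adjoint. All forms of `a` being real forces those of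
`y` to vanish, so `±y` lie in `C_n^{k-max} ⊆ C_n`, and properness gives `y = 0`. -/

namespace OpSys

open scoped ComplexOrder
open Complex

/-! ### The cones `D_n^{k-max}` and their order unit. -/

section Cones

variable {V : Type*} [AddCommGroup V] [Module ℂ V]

lemma sandwich_apply {m n p q : Type*} [Fintype m] [Fintype n]
    (A : Matrix p m ℂ) (v : Matrix m n V) (B : Matrix n q ℂ) (a : p) (b : q) :
    sandwich A v B a b = ∑ i, ∑ j, (A a i * B j b) • v i j := rfl

lemma sandwich_sandwich {m n m' n' p q : Type*} [Fintype m] [Fintype n] [Fintype m'] [Fintype n']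
    (A : Matrix p m ℂ) (A' : Matrix m m' ℂ) (v : Matrix m' n' V) (B' : Matrix n' n ℂ)
    (B : Matrix n q ℂ) :
    sandwich A (sandwich A' v B') B = sandwich (A * A') v (B' * B) := by
  ext a b
  simp only [sandwich_apply, Matrix.mul_apply, Finset.smul_sum, smul_smul, Finset.sum_mul_sum,
    Finset.sum_smul]
  rw [Finset.sum_congr rfl fun i _ => Finset.sum_comm, Finset.sum_comm]
  refine Finset.sum_congr rfl fun i' _ => ?_
  rw [Finset.sum_congr rfl fun i _ => Finset.sum_comm, Finset.sum_comm]
  refine Finset.sum_congr rfl fun j' _ => Finset.sum_congr rfl fun i _ =>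
    Finset.sum_congr rfl fun j _ => ?_
  congr 1
  ring

/-- Cutting `A` into column blocks turns `A D A*` into a sum of terms `A_l D_l A_l*`, a form in
which closure under addition amounts to concatenation. -/
lemma mem_kMaxD_iff {C : MatrixCones V} {k n : ℕ} {v : Matrix (Fin n) (Fin n) V} :
    v ∈ kMaxD C k n ↔ ∃ (m : ℕ) (A : Fin m → Matrix (Fin n) (Fin k) ℂ)
      (D : Fin m → Matrix (Fin k) (Fin k) V),
      (∀ l, D l ∈ C k) ∧ v = ∑ l, sandwich (A l) (D l) (A l)ᴴ := by
  have key : ∀ (m : ℕ) (A : Matrix (Fin n) (Fin k × Fin m) ℂ)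
      (D : Fin m → Matrix (Fin k) (Fin k) V), sandwich A (Matrix.blockDiagonal D) Aᴴ =
        ∑ l, sandwich (Matrix.of fun p c => A p (c, l)) (D l)
          (Matrix.of fun p c => A p (c, l))ᴴ := by
    intro m A D
    ext a b
    simp only [sandwich_apply, Matrix.sum_apply, Fintype.sum_prod_type,
      Matrix.blockDiagonal_apply, smul_ite, smul_zero, Finset.sum_ite_eq, Finset.mem_univ, if_true,
      Matrix.conjTranspose_apply, Matrix.of_apply]
    rw [Finset.sum_comm]
  constructor
  · rintro ⟨m, A, D, hD, rfl⟩
    exact ⟨m, _, D, hD, key m A D⟩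
  · rintro ⟨m, A, D, hD, rfl⟩
    refine ⟨m, Matrix.of fun p c => A c.2 p c.1, D, hD, ?_⟩
    rw [key]
    rfl

lemma sandwich_mem_kMaxD {C : MatrixCones V} {k n : ℕ} {w : Matrix (Fin k) (Fin k) V}
    (hw : w ∈ C k) (A : Matrix (Fin n) (Fin k) ℂ) : sandwich A w Aᴴ ∈ kMaxD C k n :=
  mem_kMaxD_iff.2 ⟨1, fun _ => A, fun _ => w, fun _ => hw, by simp⟩

lemma zero_mem_kMaxD (C : MatrixCones V) (k n : ℕ) : 0 ∈ kMaxD C k n :=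
  mem_kMaxD_iff.2 ⟨0, fun _ => 0, fun _ => 0, fun l => l.elim0, by simp⟩

lemma add_mem_kMaxD {C : MatrixCones V} {k n : ℕ} {v w : Matrix (Fin n) (Fin n) V}
    (hv : v ∈ kMaxD C k n) (hw : w ∈ kMaxD C k n) : v + w ∈ kMaxD C k n := by
  obtain ⟨m, A, D, hD, rfl⟩ := mem_kMaxD_iff.1 hv
  obtain ⟨m', A', D', hD', rfl⟩ := mem_kMaxD_iff.1 hw
  refine mem_kMaxD_iff.2 ⟨m + m', Fin.append A A', Fin.append D D', fun l => ?_, ?_⟩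
  · refine Fin.addCases (fun i => ?_) (fun i => ?_) l
    · simpa using hD i
    · simpa using hD' i
  · simp [Fin.sum_univ_add]

lemma sum_mem_kMaxD {C : MatrixCones V} {k n : ℕ} {ι : Type*} (s : Finset ι)
    {v : ι → Matrix (Fin n) (Fin n) V} (hv : ∀ i ∈ s, v i ∈ kMaxD C k n) :
    ∑ i ∈ s, v i ∈ kMaxD C k n :=
  Finset.sum_induction v (· ∈ kMaxD C k n) (fun _ _ => add_mem_kMaxD) (zero_mem_kMaxD C k n) hv

lemma smul_mem_kMaxD [StarAddMonoid V] {C : MatrixCones V} (hC : IsMatrixOrdering C) {k n : ℕ}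
    {r : ℝ} (hr : 0 ≤ r) {v : Matrix (Fin n) (Fin n) V}
    (hv : v ∈ kMaxD C k n) : (r : ℂ) • v ∈ kMaxD C k n := by
  obtain ⟨m, A, D, hD, rfl⟩ := mem_kMaxD_iff.1 hv
  refine mem_kMaxD_iff.2 ⟨m, A, fun l => (r : ℂ) • D l,
    fun l => (hC.properCone k).smul_mem r hr _ (hD l), ?_⟩
  rw [Finset.smul_sum]
  refine Finset.sum_congr rfl fun l _ => ?_
  ext a b
  simp only [Matrix.smul_apply, sandwich_apply, Finset.smul_sum]
  exact Finset.sum_congr rfl fun i _ => Finset.sum_congr rfl fun j _ => smul_comm _ _ _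

lemma zero_mem_cone [StarAddMonoid V] {C : MatrixCones V} (hC : IsMatrixOrdering C) (n : ℕ) :
    0 ∈ C n := by
  obtain ⟨v, hv⟩ := (hC.properCone n).nonempty
  simpa using (hC.properCone n).smul_mem 0 le_rfl v hv

lemma kMaxD_subset [StarAddMonoid V] {C : MatrixCones V} (hC : IsMatrixOrdering C) (k n : ℕ) :
    kMaxD C k n ⊆ C n := by
  intro v hv
  obtain ⟨m, A, D, hD, rfl⟩ := mem_kMaxD_iff.1 hv
  refine Finset.sum_induction _ (· ∈ C n) (fun a b ha hb => (hC.properCone n).add_mem a ha b hb)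
    (zero_mem_cone hC n) fun l _ => ?_
  simpa using hC.compatible k n (A l)ᴴ (D l) (hD l)

lemma kMax_subset [StarAddMonoid V] [StarModule ℂ V] {C : MatrixCones V} {e : V}
    (hS : IsOperatorSystem C e) (k n : ℕ) : kMax C e k n ⊆ C n := fun _ hv =>
  hS.archimedean n _ fun t ht => kMaxD_subset hS.matrixOrdering k n (hv t ht)

/-- The elementary tensor `P ⊗ s`. -/
def tensor {n : ℕ} (P : Matrix (Fin n) (Fin n) ℂ) (s : V) : Matrix (Fin n) (Fin n) V :=
  Matrix.of fun i j => P i j • s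

/-- With `P = B* B`, the tensor is a sum of rank-one terms, one for each row of `B`. Each is a
compression of `s` placed in a corner of a `k × k` matrix, which is where `1 ≤ k` enters. -/
lemma tensor_mem_kMaxD [StarAddMonoid V] {C : MatrixCones V} (hC : IsMatrixOrdering C)
    {k n : ℕ} (hk : 1 ≤ k) {P : Matrix (Fin n) (Fin n) ℂ} (hP : P.PosSemidef) {s : V}
    (hs : (Matrix.of fun _ _ => s : Matrix (Fin 1) (Fin 1) V) ∈ C 1) :
    tensor P s ∈ kMaxD C k n := by
  open scoped MatrixOrder Matrix.Norms.L2Operator in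
  obtain ⟨B, hB⟩ := CStarAlgebra.nonneg_iff_eq_star_mul_self.1 hP.nonneg
  let z : Fin k := ⟨0, hk⟩
  let X : Matrix (Fin 1) (Fin k) ℂ := Matrix.of fun _ c => if c = z then 1 else 0
  have h1 : ∀ l, sandwich (Matrix.of fun i c => if c = z then star (B l i) else 0)
      (sandwich Xᴴ (Matrix.of fun _ _ => s : Matrix (Fin 1) (Fin 1) V) X)
      (Matrix.of fun i c => if c = z then star (B l i) else 0)ᴴ ∈ kMaxD C k n := fun l =>
    sandwich_mem_kMaxD (hC.compatible 1 k X _ hs) _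
  convert sum_mem_kMaxD Finset.univ fun l _ => h1 l
  ext i j
  simp only [tensor, Matrix.of_apply, Matrix.sum_apply, sandwich_sandwich]
  rw [hB, Matrix.mul_apply, Finset.sum_smul]
  refine Finset.sum_congr rfl fun l _ => ?_
  simp [sandwich_apply, X, Matrix.mul_apply, apply_ite]

lemma exists_smul_one_posSemidef {n : ℕ} {H : Matrix (Fin n) (Fin n) ℂ} (hH : H.IsHermitian) :
    ∃ c : ℝ, ((c : ℂ) • (1 : Matrix (Fin n) (Fin n) ℂ) - H).PosSemidef ∧
      ((c : ℂ) • (1 : Matrix (Fin n) (Fin n) ℂ) + H).PosSemidef := by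
  open scoped MatrixOrder Matrix.Norms.L2Operator in
  refine ⟨‖H‖, ?_, ?_⟩
  · have h := IsSelfAdjoint.le_algebraMap_norm_self (a := H) hH
    rw [Algebra.algebraMap_eq_smul_one] at h
    exact h
  · have h := IsSelfAdjoint.le_algebraMap_norm_self (a := -H) hH.neg
    rw [Algebra.algebraMap_eq_smul_one, norm_neg, Matrix.le_iff, sub_neg_eq_add] at h
    exact h

lemma exists_smul_unit_sub_mem [StarAddMonoid V] [StarModule ℂ V] {C : MatrixCones V} {e : V}
    (hS : IsOperatorSystem C e) {x : V} (hx : star x = x) :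
    ∃ t : ℝ, 0 < t ∧ (Matrix.of fun _ _ => (t : ℂ) • e - x : Matrix (Fin 1) (Fin 1) V) ∈ C 1 := by
  obtain ⟨t, ht, h⟩ := hS.orderUnit 1 (Matrix.of fun _ _ => x) (by ext; simp [hx])
  refine ⟨t, ht, ?_⟩
  convert h using 1
  ext i j
  simp [ampUnit, Subsingleton.elim i j]

lemma unit_mem_cone_one [StarAddMonoid V] [StarModule ℂ V] {C : MatrixCones V} {e : V}
    (hS : IsOperatorSystem C e) : (Matrix.of fun _ _ => e : Matrix (Fin 1) (Fin 1) V) ∈ C 1 := by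
  obtain ⟨t, ht, h⟩ := exists_smul_unit_sub_mem hS (x := 0) (by simp)
  convert (hS.matrixOrdering.properCone 1).smul_mem t⁻¹ (by positivity) _ h using 1
  ext i j
  simp only [Matrix.smul_apply, Matrix.of_apply, sub_zero, smul_smul]
  rw [← ofReal_mul, inv_mul_cancel₀ ht.ne', ofReal_one, one_smul]

lemma ampUnit_mem_kMaxD [StarAddMonoid V] [StarModule ℂ V] {C : MatrixCones V} {e : V}
    (hS : IsOperatorSystem C e) {k : ℕ} (hk : 1 ≤ k) (n : ℕ) : ampUnit e n ∈ kMaxD C k n := by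
  convert tensor_mem_kMaxD hS.matrixOrdering hk (Matrix.PosSemidef.one (n := Fin n))
    (unit_mem_cone_one hS) using 1
  ext i j
  simp [tensor, ampUnit, Matrix.diagonal_apply, Matrix.one_apply]

/-- Rests on `(c - H) ⊗ (t e + x) + (c + H) ⊗ (t e - x) = 2 (c t e_n - H ⊗ x)`, where all four
factors are positive for large `c` and `t`. -/
lemma tensor_orderBounded [StarAddMonoid V] [StarModule ℂ V] {C : MatrixCones V} {e : V}
    (hS : IsOperatorSystem C e) {k n : ℕ} (hk : 1 ≤ k) {H : Matrix (Fin n) (Fin n) ℂ}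
    (hH : H.IsHermitian) {x : V} (hx : star x = x) :
    ∃ t : ℝ, (t : ℂ) • ampUnit e n - tensor H x ∈ kMaxD C k n := by
  have he := unit_mem_cone_one hS
  obtain ⟨t₁, ht₁, hx₁⟩ := exists_smul_unit_sub_mem hS hx
  obtain ⟨t₂, ht₂, hx₂⟩ := exists_smul_unit_sub_mem hS (x := -x) (by simp [hx])
  have hp : (Matrix.of fun _ _ => ((t₁ + t₂ : ℝ) : ℂ) • e - x : Matrix (Fin 1) (Fin 1) V) ∈ C 1 := by
    convert (hS.matrixOrdering.properCone 1).add_mem _ hx₁ _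
      ((hS.matrixOrdering.properCone 1).smul_mem t₂ ht₂.le _ he) using 1
    ext i j
    simp
    module
  have hm : (Matrix.of fun _ _ => ((t₁ + t₂ : ℝ) : ℂ) • e + x : Matrix (Fin 1) (Fin 1) V) ∈ C 1 := by
    convert (hS.matrixOrdering.properCone 1).add_mem _ hx₂ _
      ((hS.matrixOrdering.properCone 1).smul_mem t₁ ht₁.le _ he) using 1
    ext i j
    simp
    module
  obtain ⟨c, hc₁, hc₂⟩ := exists_smul_one_posSemidef hH
  have hsum := smul_mem_kMaxD hS.matrixOrdering (r := 1 / 2) (by norm_num) (add_mem_kMaxD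
    (tensor_mem_kMaxD hS.matrixOrdering (k := k) hk hc₁ hm)
    (tensor_mem_kMaxD hS.matrixOrdering (k := k) hk hc₂ hp))
  refine ⟨c * (t₁ + t₂), ?_⟩
  convert hsum using 1
  ext i j
  obtain rfl | hij := eq_or_ne i j
  · simp [tensor, ampUnit]
    module
  · simp [tensor, ampUnit, hij]
    module

/-- The unit is an order unit for the cones `D_n^{k-max}`. -/
lemma kMaxD_orderUnit [StarAddMonoid V] [StarModule ℂ V] {C : MatrixCones V} {e : V}
    (hS : IsOperatorSystem C e) {k n : ℕ} (hk : 1 ≤ k) {v : Matrix (Fin n) (Fin n) V}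
    (hv : vᴴ = v) : ∃ t : ℝ, (t : ℂ) • ampUnit e n - v ∈ kMaxD C k n := by
  let x : Fin n → Fin n → V := fun i j => (realPart (v i j) : V)
  let y : Fin n → Fin n → V := fun i j => (imaginaryPart (v i j) : V)
  have hx : ∀ i j, star (x i j) = x i j := fun i j => (realPart (v i j)).2
  have hy : ∀ i j, star (y i j) = y i j := fun i j => (imaginaryPart (v i j)).2
  have hxy : ∀ i j, v i j = x i j + I • y i j := fun i j =>
    (realPart_add_I_smul_imaginaryPart (v i j)).symm
  let P : Fin n → Fin n → Matrix (Fin n) (Fin n) ℂ := fun i j =>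
    Matrix.single i j 1 + Matrix.single j i 1
  let Q : Fin n → Fin n → Matrix (Fin n) (Fin n) ℂ := fun i j =>
    Matrix.single i j I + Matrix.single j i (-I)
  have hP : ∀ i j, (P i j).IsHermitian := fun i j => by
    simp [P, Matrix.IsHermitian, Matrix.conjTranspose_single, add_comm]
  have hQ : ∀ i j, (Q i j).IsHermitian := fun i j => by
    simp [Q, Matrix.IsHermitian, Matrix.conjTranspose_single, add_comm]
  choose t ht using fun i j => tensor_orderBounded hS hk (hP i j) (hx i j)
  choose s hs using fun i j => tensor_orderBounded hS hk (hQ i j) (hy i j)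
  -- The terms `P i j ⊗ x i j + Q i j ⊗ y i j`, summed over all ordered pairs, count `v` twice;
  -- hence the factor `1 / 2`.
  refine ⟨(1 / 2 : ℝ) * ∑ i, ∑ j, (t i j + s i j), ?_⟩
  have hsum := smul_mem_kMaxD hS.matrixOrdering (r := 1 / 2) (by norm_num)
    (sum_mem_kMaxD Finset.univ fun i _ => sum_mem_kMaxD Finset.univ fun j _ =>
      add_mem_kMaxD (ht i j) (hs i j))
  convert hsum using 1
  have hterm : ∀ i j, tensor (P i j) (x i j) + tensor (Q i j) (y i j) =
      Matrix.single i j (v i j) + Matrix.single j i (v j i) := by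
    intro i j
    have hji : v j i = x i j - I • y i j := by
      have : star (v i j) = v j i := by rw [← Matrix.conjTranspose_apply, hv]
      rw [← this, hxy, star_add, star_smul, hx, hy]
      simp [sub_eq_add_neg]
    rw [hji, hxy i j]
    ext a b
    simp only [tensor, P, Q, Matrix.add_apply, Matrix.of_apply, Matrix.single_apply]
    split_ifs <;> simp <;> module
  have h2 : ∑ i, ∑ j, (tensor (P i j) (x i j) + tensor (Q i j) (y i j)) = (2 : ℂ) • v := by
    simp_rw [hterm, Finset.sum_add_distrib]
    rw [Finset.sum_comm (f := fun i j => Matrix.single j i (v j i)),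
      ← Matrix.matrix_eq_sum_single, two_smul]
  have h3 : ∀ i j, (t i j : ℂ) • ampUnit e n - tensor (P i j) (x i j) +
      ((s i j : ℂ) • ampUnit e n - tensor (Q i j) (y i j)) =
      ((t i j + s i j : ℝ) : ℂ) • ampUnit e n -
        (tensor (P i j) (x i j) + tensor (Q i j) (y i j)) := by
    intro i j
    push_cast
    module
  simp_rw [h3, Finset.sum_sub_distrib]
  simp_rw [← Finset.sum_smul]
  rw [h2]
  push_cast
  module

end Cones

/-! ### Positivity of operator matrices through quadratic forms. -/

section Forms

variable {H : Type*} [NormedAddCommGroup H] [InnerProductSpace ℂ H]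

/-- The quadratic form of a matrix of operators. -/
noncomputable def opForm {n : ℕ} (T : Matrix (Fin n) (Fin n) (H →L[ℂ] H)) (x : Fin n → H) : ℂ :=
  ∑ i, ∑ j, inner ℂ (x i) (T i j (x j))

/-- Over `ℂ` a real-valued quadratic form already forces self-adjointness; the order on `ℂ` encodes
both reality and non-negativity. -/
lemma mem_opCones_iff {n : ℕ} {T : Matrix (Fin n) (Fin n) (H →L[ℂ] H)} :
    T ∈ opCones H n ↔ ∀ x, 0 ≤ opForm T x := by
  have key : ∀ x : PiLp 2 (fun _ : Fin n => H),
      inner ℂ (matrixOperator T x) x = star (opForm T x) := by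
    intro x
    simp only [opForm, PiLp.inner_apply, matrixOperator, star_sum]
    refine Finset.sum_congr rfl fun i _ => ?_
    rw [← inner_conj_symm]
    simp [inner_sum]
  have h2 : ∀ z : ℂ, (((star z).re : ℂ) = star z ∧ 0 ≤ (star z).re) ↔ 0 ≤ z := by
    intro z
    rw [Complex.le_def]
    simp [Complex.ext_iff, eq_comm, and_comm]
  change (matrixOperator T).IsPositive ↔ _
  rw [ContinuousLinearMap.isPositive_iff_complex]
  constructor
  · intro h x
    have := h (WithLp.toLp 2 x)
    rw [key] at this
    exact (h2 _).1 this
  · intro h x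
    rw [key]
    exact (h2 _).2 (h x)

variable {V : Type*} [AddCommGroup V] [Module ℂ V]

lemma opForm_add {n : ℕ} (T T' : Matrix (Fin n) (Fin n) (H →L[ℂ] H)) (x : Fin n → H) :
    opForm (T + T') x = opForm T x + opForm T' x := by
  simp [opForm, Finset.sum_add_distrib]

lemma opForm_smul {n : ℕ} (c : ℂ) (T : Matrix (Fin n) (Fin n) (H →L[ℂ] H)) (x : Fin n → H) :
    opForm (c • T) x = c * opForm T x := by
  simp [opForm, Finset.mul_sum]

/-- The quadratic form of the amplification of a linear map, as a linear functional. -/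
noncomputable def ampForm (φ : V →ₗ[ℂ] (H →L[ℂ] H)) {n : ℕ} (x : Fin n → H) :
    Matrix (Fin n) (Fin n) V →ₗ[ℂ] ℂ where
  toFun v := opForm (v.map φ) x
  map_add' v w := by rw [← opForm_add]; congr 1; ext; simp
  map_smul' c v := by
    rw [RingHom.id_apply, smul_eq_mul, ← opForm_smul]; congr 1; ext; simp

lemma ampForm_apply (φ : V →ₗ[ℂ] (H →L[ℂ] H)) {n : ℕ} (x : Fin n → H)
    (v : Matrix (Fin n) (Fin n) V) :
    ampForm φ x v = ∑ i, ∑ j, inner ℂ (x i) (φ (v i j) (x j)) := rfl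

lemma map_mem_opCones_iff {φ : V →ₗ[ℂ] (H →L[ℂ] H)} {n : ℕ} {v : Matrix (Fin n) (Fin n) V} :
    v.map φ ∈ opCones H n ↔ ∀ x, 0 ≤ ampForm φ x v := mem_opCones_iff

lemma ampForm_sandwich (φ : V →ₗ[ℂ] (H →L[ℂ] H)) {k n : ℕ} (x : Fin n → H)
    (A : Matrix (Fin n) (Fin k) ℂ) (w : Matrix (Fin k) (Fin k) V) :
    ampForm φ x (sandwich A w Aᴴ) = ampForm φ (fun c => ∑ i, star (A i c) • x i) w := by
  simp only [ampForm_apply, sandwich, Matrix.of_apply, map_sum, map_smul,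
    Matrix.conjTranspose_apply, _root_.sum_apply, _root_.smul_apply,
    inner_sum, sum_inner, inner_smul_left, inner_smul_right]
  rw [Finset.sum_congr rfl fun i _ => Finset.sum_comm, Finset.sum_comm]
  refine Finset.sum_congr rfl fun a _ => ?_
  rw [Finset.sum_congr rfl fun i _ => Finset.sum_comm, Finset.sum_comm]
  refine Finset.sum_congr rfl fun b _ => ?_
  rw [Finset.sum_comm]
  refine Finset.sum_congr rfl fun j _ => ?_
  rw [Finset.mul_sum]
  refine Finset.sum_congr rfl fun i _ => ?_
  simp
  ring

lemma ampForm_ampUnit {φ : V →ₗ[ℂ] (H →L[ℂ] H)} {e : V} (he : φ e = 1) {n : ℕ} (x : Fin n → H) :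
    ampForm φ x (ampUnit e n) = ((∑ i, ‖x i‖ ^ 2 : ℝ) : ℂ) := by
  rw [ampForm_apply, ofReal_sum]
  refine Finset.sum_congr rfl fun i _ => ?_
  rw [Finset.sum_eq_single i]
  · simp [ampUnit, he, inner_self_eq_norm_sq_to_K]
  · intro j _ hj
    simp [ampUnit, hj.symm]
  · simp

end Forms

/-! ### The forward implication. -/

section Positive

variable {V : Type*} [AddCommGroup V] [Module ℂ V]
  {H : Type*} [NormedAddCommGroup H] [InnerProductSpace ℂ H]

lemma ampForm_nonneg_of_mem_kMaxD {C : MatrixCones V} {k : ℕ} {φ : V →ₗ[ℂ] (H →L[ℂ] H)}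
    (hφ : IsKPositive C (opCones H) k φ) {n : ℕ} {v : Matrix (Fin n) (Fin n) V}
    (hv : v ∈ kMaxD C k n) (x : Fin n → H) : 0 ≤ ampForm φ x v := by
  obtain ⟨m, A, D, hD, rfl⟩ := mem_kMaxD_iff.1 hv
  rw [map_sum]
  refine Finset.sum_nonneg fun l _ => ?_
  rw [ampForm_sandwich]
  exact map_mem_opCones_iff.1 (hφ _ (hD l)) _

lemma ampForm_nonneg_of_mem_kMax {C : MatrixCones V} {e : V} {k : ℕ} {φ : V →ₗ[ℂ] (H →L[ℂ] H)}
    (he : φ e = 1) (hφ : IsKPositive C (opCones H) k φ) {n : ℕ} {v : Matrix (Fin n) (Fin n) V}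
    (hv : v ∈ kMax C e k n) (x : Fin n → H) : 0 ≤ ampForm φ x v := by
  have h : ∀ r : ℝ, 0 < r → 0 ≤ r * (∑ i, ‖x i‖ ^ 2) + (ampForm φ x v).re ∧
      (ampForm φ x v).im = 0 := by
    intro r hr
    have := ampForm_nonneg_of_mem_kMaxD hφ (hv r hr) x
    rw [map_add, map_smul, ampForm_ampUnit he, Complex.le_def] at this
    simpa [← ofReal_pow, eq_comm] using this
  refine Complex.le_def.2 ⟨?_, ((h 1 one_pos).2).symm⟩
  have hN : (0 : ℝ) ≤ ∑ i, ‖x i‖ ^ 2 := by positivity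
  generalize (∑ i, ‖x i‖ ^ 2 : ℝ) = N at h hN
  refine le_of_forall_pos_le_add fun ε hε => ?_
  -- This `r` makes `r N ≤ ε`; the `+ 1` covers `N = 0`.
  have h1 := (h (ε / (N + 1)) (by positivity)).1
  have h2 : ε / (N + 1) * N ≤ ε := by
    rw [div_mul_eq_mul_div, div_le_iff₀ (by positivity)]
    nlinarith
  rw [zero_re]
  linarith

/-- No `*`-preservation is assumed of `φ`: it follows because the form is real on `t e_n - v` and on
`e_n`. -/
lemma ampForm_im_eq_zero [StarAddMonoid V] [StarModule ℂ V] {C : MatrixCones V} {e : V}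
    (hS : IsOperatorSystem C e) {k n : ℕ} (hk : 1 ≤ k) {φ : V →ₗ[ℂ] (H →L[ℂ] H)}
    (he : φ e = 1) (hφ : IsKPositive C (opCones H) k φ) {v : Matrix (Fin n) (Fin n) V}
    (hv : vᴴ = v) (x : Fin n → H) : (ampForm φ x v).im = 0 := by
  obtain ⟨t, ht⟩ := kMaxD_orderUnit hS hk hv
  have := ampForm_nonneg_of_mem_kMaxD hφ ht x
  rw [map_sub, map_smul, ampForm_ampUnit he, Complex.le_def] at this
  simpa [← ofReal_pow] using this.2

end Positive

/-! ### Algebraic separation from a cone with an order unit. -/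

section Separation

lemma exists_separating_functional {E : Type*} [AddCommGroup E] [Module ℝ E]
    (D : PointedCone ℝ E) (u : E) (σ : E →ₗ[ℝ] E) (hσu : σ u = u) (hu : u ∈ D)
    (hunit : ∀ v, ∃ t : ℝ, t • u + σ v ∈ D) {w : E} (hσw : σ w = w) (hw : w ∉ D) :
    ∃ f : E →ₗ[ℝ] ℝ, f u = 1 ∧ (∀ v ∈ D, σ v = v → 0 ≤ f v) ∧ f w ≤ 0 ∧
      ∀ v, σ v = 0 → f v = 0 := by
  -- Adjoining `w` to the cone forces `f (-w) ≥ 0`, since `-w ∈ K`; testing only `σ v` puts `ker σ`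
  -- in `K ∩ -K`, so `f` vanishes there. Riesz extension starts from `t • u ↦ t`.
  let K : PointedCone ℝ E :=
    { carrier := {v | ∃ r : ℝ, 0 ≤ r ∧ σ v + r • w ∈ D}
      add_mem' := by
        rintro v v' ⟨r, hr, h⟩ ⟨r', hr', h'⟩
        refine ⟨r + r', add_nonneg hr hr', ?_⟩
        convert D.add_mem h h' using 1
        rw [map_add]
        module
      zero_mem' := ⟨0, le_rfl, by simp⟩
      smul_mem' := by
        intro c v ⟨r, hr, h⟩
        obtain ⟨c, hc⟩ : {c : ℝ // 0 ≤ c} := c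
        refine ⟨c * r, mul_nonneg hc hr, ?_⟩
        convert D.smul_mem hc h using 1
        change σ (c • v) + (c * r) • w = c • (σ v + r • w)
        rw [map_smul]
        module }
  have hD : ∀ {c : ℝ}, 0 ≤ c → ∀ {v : E}, v ∈ D → c • v ∈ D := fun hc _ hv => D.smul_mem hc hv
  have hneg : -u ∉ D := by
    intro hneg
    obtain ⟨t, ht⟩ := hunit w
    rw [hσw] at ht
    obtain ht0 | ht0 := le_total 0 t
    · exact hw (by simpa using D.add_mem ht (hD ht0 hneg))
    · exact hw (by simpa using D.add_mem ht (hD (neg_nonneg.2 ht0) hu))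
  have hu0 : u ≠ 0 := by
    rintro rfl
    exact hneg (by simp)
  have hspan : ∀ (t : ℝ) (h), 
      LinearPMap.mkSpanSingleton (σ := RingHom.id ℝ) u (1 : ℝ) hu0 ⟨t • u, h⟩ = t :=
    fun t h => (LinearPMap.mkSpanSingleton'_apply _ _ _ _ _).trans (by simp)
  suffices h : (∀ x : (LinearPMap.mkSpanSingleton (σ := RingHom.id ℝ) u (1 : ℝ) hu0).domain,
      (x : E) ∈ K → 0 ≤ LinearPMap.mkSpanSingleton (σ := RingHom.id ℝ) u (1 : ℝ) hu0 x) ∧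
      ∀ y, ∃ x : (LinearPMap.mkSpanSingleton (σ := RingHom.id ℝ) u (1 : ℝ) hu0).domain,
        (x : E) + y ∈ K by
    obtain ⟨f, hf, hfK⟩ := riesz_extension K (LinearPMap.mkSpanSingleton u 1 hu0) h.1 h.2
    have hmem : ∀ v, σ v ∈ D → 0 ≤ f v := fun v hv => hfK v ⟨0, le_rfl, by simpa using hv⟩
    refine ⟨f, ?_, fun v hv h => hmem v (by rwa [h]), ?_, fun v hv => ?_⟩
    · exact (hf ⟨u, Submodule.mem_span_singleton_self u⟩).trans
        (LinearPMap.mkSpanSingleton_apply ..)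
    · have := hfK (-w) ⟨1, zero_le_one, by simp [hσw]⟩
      simpa using this
    · refine le_antisymm ?_ (hmem v (by simp [hv]))
      simpa using hmem (-v) (by simp [hv])
  constructor
  · rintro ⟨x, hx⟩ ⟨r, hr, h⟩
    obtain ⟨t, rfl⟩ := Submodule.mem_span_singleton.1 hx
    rw [hspan]
    by_contra! ht
    rw [map_smul, hσu] at h
    obtain rfl | hr := hr.eq_or_lt
    · refine hneg ?_
      convert hD (c := (-t)⁻¹) (by rw [inv_nonneg]; linarith) h using 1
      rw [zero_smul, add_zero, smul_smul, inv_neg, neg_mul, inv_mul_cancel₀ ht.ne, neg_one_smul]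
    · refine hw ?_
      convert hD (inv_nonneg.2 hr.le) (D.add_mem h (hD (c := -t) (by linarith) hu)) using 1
      rw [neg_smul, add_neg_cancel_comm, smul_smul, inv_mul_cancel₀ hr.ne', one_smul]
  · intro y
    obtain ⟨t, ht⟩ := hunit y
    refine ⟨⟨t • u, Submodule.smul_mem _ _ (Submodule.mem_span_singleton_self u)⟩, 0, le_rfl, ?_⟩
    simpa [hσu] using ht

end Separation

/-! ### From separating functionals to matrix-valued maps. -/

section Functional

lemma sum_comm_pairs {α β γ δ M : Type*} [Fintype α] [Fintype β] [Fintype γ] [Fintype δ]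
    [AddCommMonoid M] (f : α → β → γ → δ → M) :
    ∑ a, ∑ b, ∑ c, ∑ d, f a b c d = ∑ c, ∑ d, ∑ a, ∑ b, f a b c d := by
  simpa [Fintype.sum_prod_type] using Finset.sum_comm (s := Finset.univ) (t := Finset.univ)
    (f := fun (p : α × β) (q : γ × δ) => f p.1 p.2 q.1 q.2)

variable {V : Type*} [AddCommGroup V] [Module ℂ V]

/-- Separation gives only `f (r e_n + a) ≤ 0`; the margin `r > 0` and `f e_n = 1` turn this into
strict negativity at `a`. -/
lemma exists_functional [StarAddMonoid V] [StarModule ℂ V] {C : MatrixCones V} {e : V}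
    (hS : IsOperatorSystem C e) {k n : ℕ} (hk : 1 ≤ k) {a : Matrix (Fin n) (Fin n) V}
    (ha : aᴴ = a) (hna : a ∉ kMax C e k n) :
    ∃ F : Matrix (Fin n) (Fin n) V →ₗ[ℂ] ℂ, F (ampUnit e n) = 1 ∧
      (∀ v ∈ kMaxD C k n, 0 ≤ F v) ∧ (F a).re < 0 := by
  obtain ⟨r, hr, hw⟩ : ∃ r : ℝ, 0 < r ∧ (r : ℂ) • ampUnit e n + a ∉ kMaxD C k n := by
    simpa [kMax] using hna
  have hsmul : ∀ (c : ℝ) (v : Matrix (Fin n) (Fin n) V), c • v = (c : ℂ) • v := fun _ _ => rfl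
  have hu : (ampUnit e n)ᴴ = ampUnit e n := by
    rw [ampUnit, Matrix.diagonal_conjTranspose]
    simp [Pi.star_def, hS.unit_selfAdjoint]
  let D : PointedCone ℝ (Matrix (Fin n) (Fin n) V) :=
    { carrier := kMaxD C k n
      add_mem' := add_mem_kMaxD
      zero_mem' := zero_mem_kMaxD C k n
      smul_mem' := fun c _ hv => smul_mem_kMaxD hS.matrixOrdering c.2 hv }
  let σ : Matrix (Fin n) (Fin n) V →ₗ[ℝ] Matrix (Fin n) (Fin n) V :=
    { toFun := fun v => (1 / 2 : ℝ) • (v + vᴴ)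
      map_add' := fun v w => by rw [Matrix.conjTranspose_add]; module
      map_smul' := fun c v => by
        have : (c • v)ᴴ = c • vᴴ := by rw [hsmul, hsmul, Matrix.conjTranspose_smul]; simp
        rw [this, RingHom.id_apply]; module }
  have hσ : ∀ v, σ v = (1 / 2 : ℝ) • (v + vᴴ) := fun _ => rfl
  have hσs : ∀ v, vᴴ = v → σ v = v := fun v hv => by
    rw [hσ, hv]
    module
  have hσa : ∀ v, vᴴ = v → σ (I • v) = 0 := fun v hv => by
    rw [hσ, Matrix.conjTranspose_smul, hv]
    simp
  have hsa : ∀ v, (σ v)ᴴ = σ v := fun v => by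
    rw [hσ, hsmul, Matrix.conjTranspose_smul]
    simp [add_comm]
  have hwa : ((r : ℂ) • ampUnit e n + a)ᴴ = (r : ℂ) • ampUnit e n + a := by
    rw [Matrix.conjTranspose_add, Matrix.conjTranspose_smul, hu, ha]
    simp
  obtain ⟨f, hfu, hfD, hfw, hf0⟩ := exists_separating_functional D (ampUnit e n) σ (hσs _ hu)
    (ampUnit_mem_kMaxD hS hk n) (fun v => by
      obtain ⟨t, ht⟩ := kMaxD_orderUnit hS hk (v := -σ v) (by simp [hsa])
      exact ⟨t, by rwa [sub_neg_eq_add] at ht⟩) (w := (r : ℂ) • ampUnit e n + a) (hσs _ hwa) hw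
  -- The complexification is `f v - i f (i v)`, and `f` kills the skew-adjoint `i v`.
  have hF : ∀ v, vᴴ = v → (Module.Dual.extendRCLike f : Matrix (Fin n) (Fin n) V →ₗ[ℂ] ℂ) v = f v := by
    intro v hv
    rw [Module.Dual.extendRCLike_apply]
    have := hf0 _ (hσa v hv)
    simp [this]
  refine ⟨Module.Dual.extendRCLike f, ?_, fun v hv => ?_, ?_⟩
  · rw [hF _ hu, hfu, ofReal_one]
  · have hv' := (hS.matrixOrdering.properCone n).selfAdjoint v
      (kMaxD_subset hS.matrixOrdering k n hv)
    rw [hF _ hv']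
    exact_mod_cast hfD v hv (hσs v hv')
  · rw [hF _ ha, ofReal_re]
    rw [← hsmul, map_add, map_smul, hfu, smul_eq_mul] at hfw
    linarith

variable {n : ℕ}

/-- The matrix-valued map `s ↦ (F (E_{ij} ⊗ s))` associated with a functional `F` on matrices. -/
noncomputable def matrixMap (F : Matrix (Fin n) (Fin n) V →ₗ[ℂ] ℂ) :
    V →ₗ[ℂ] Matrix (Fin n) (Fin n) ℂ where
  toFun s := Matrix.of fun i j => F (Matrix.single i j s)
  map_add' s t := by ext; simp [Matrix.single_add]
  map_smul' c s := by ext; simp [← Matrix.smul_single]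

lemma matrixMap_apply (F : Matrix (Fin n) (Fin n) V →ₗ[ℂ] ℂ) (s : V) (i j : Fin n) :
    matrixMap F s i j = F (Matrix.single i j s) := rfl

/-- The sesquilinear form of the amplification of a matrix-valued map. -/
noncomputable def matrixForm (φ : V →ₗ[ℂ] Matrix (Fin n) (Fin n) ℂ) {k : ℕ}
    (x : Fin k → Fin n → ℂ) (w : Matrix (Fin k) (Fin k) V) : ℂ :=
  ∑ a, ∑ b, star (x a) ⬝ᵥ (φ (w a b) *ᵥ x b)

/-- For `w ∈ C_k` the right-hand argument lies in `D_n^{k-max}`, so positivity of `F` there becomes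
`k`-positivity of `matrixMap F`. -/
lemma matrixForm_matrixMap (F : Matrix (Fin n) (Fin n) V →ₗ[ℂ] ℂ) {k : ℕ}
    (x : Fin k → Fin n → ℂ) (w : Matrix (Fin k) (Fin k) V) :
    matrixForm (matrixMap F) x w = F (sandwich (Matrix.of x)ᴴ w (Matrix.of x)) := by
  rw [Matrix.matrix_eq_sum_single (sandwich (Matrix.of x)ᴴ w (Matrix.of x))]
  simp only [matrixForm, dotProduct, Matrix.mulVec, matrixMap_apply, map_sum, Finset.mul_sum,
    sandwich_apply, ← Matrix.singleAddMonoidHom_apply]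
  simp only [Matrix.singleAddMonoidHom_apply, ← Matrix.smul_single, map_smul, smul_eq_mul]
  rw [Finset.sum_congr rfl fun i _ => Finset.sum_comm, Finset.sum_comm]
  refine Finset.sum_congr rfl fun a _ => ?_
  rw [Finset.sum_congr rfl fun i _ => Finset.sum_comm, Finset.sum_comm]
  refine Finset.sum_congr rfl fun b _ => ?_
  refine Finset.sum_congr rfl fun j _ => Finset.sum_congr rfl fun i _ => ?_
  simp
  ring

/-- The perturbation `s ↦ φ s + ε tr (φ s) 1` of a matrix-valued map. -/
noncomputable def tracePerturb (φ : V →ₗ[ℂ] Matrix (Fin n) (Fin n) ℂ) (ε : ℝ) :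
    V →ₗ[ℂ] Matrix (Fin n) (Fin n) ℂ :=
  φ + (ε : ℂ) • ((Matrix.traceLinearMap (Fin n) ℂ ℂ).smulRight 1 ∘ₗ φ)

lemma tracePerturb_apply (φ : V →ₗ[ℂ] Matrix (Fin n) (Fin n) ℂ) (ε : ℝ) (s : V) :
    tracePerturb φ ε s = φ s + ((ε : ℂ) * (φ s).trace) • 1 := by
  simp [tracePerturb, smul_smul]

/-- The trace term is itself a sum of forms of `φ` at other vectors, so the perturbation inherits
`k`-positivity when `ε ≥ 0`. -/
lemma matrixForm_tracePerturb (φ : V →ₗ[ℂ] Matrix (Fin n) (Fin n) ℂ) (ε : ℝ) {k : ℕ}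
    (x : Fin k → Fin n → ℂ) (w : Matrix (Fin k) (Fin k) V) :
    matrixForm (tracePerturb φ ε) x w = matrixForm φ x w +
      ε * ∑ i, ∑ p, matrixForm φ (fun a => Pi.single p (x a i)) w := by
  simp only [matrixForm, tracePerturb_apply, Matrix.add_mulVec, dotProduct_add,
    Finset.sum_add_distrib, add_right_inj, Matrix.smul_mulVec, Matrix.one_mulVec, dotProduct_smul]
  have h : ∀ (i p : Fin n) (a b : Fin k), star (Pi.single p (x a i) : Fin n → ℂ) ⬝ᵥ
      (φ (w a b) *ᵥ Pi.single p (x b i)) = star (x a i) * x b i * φ (w a b) p p := by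
    intro i p a b
    rw [← Pi.single_star, single_dotProduct, Matrix.mulVec_single]
    simp
    ring
  simp_rw [h]
  rw [sum_comm_pairs]
  rw [Finset.mul_sum]
  refine Finset.sum_congr rfl fun a _ => ?_
  rw [Finset.mul_sum]
  refine Finset.sum_congr rfl fun b _ => ?_
  simp only [← Finset.mul_sum]
  rw [← Finset.sum_mul, smul_eq_mul]
  simp only [dotProduct, Matrix.trace, Matrix.diag_apply, Pi.star_apply]
  ring

/-- The compression `s ↦ R* φ(s) R` of a matrix-valued map. -/
noncomputable def conjMap (φ : V →ₗ[ℂ] Matrix (Fin n) (Fin n) ℂ) (R : Matrix (Fin n) (Fin n) ℂ) :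
    V →ₗ[ℂ] Matrix (Fin n) (Fin n) ℂ where
  toFun s := Rᴴ * φ s * R
  map_add' s t := by simp [mul_add, add_mul]
  map_smul' c s := by simp

lemma matrixForm_conjMap (φ : V →ₗ[ℂ] Matrix (Fin n) (Fin n) ℂ) (R : Matrix (Fin n) (Fin n) ℂ)
    {k : ℕ} (x : Fin k → Fin n → ℂ) (w : Matrix (Fin k) (Fin k) V) :
    matrixForm (conjMap φ R) x w = matrixForm φ (fun a => R *ᵥ x a) w := by
  refine Finset.sum_congr rfl fun a _ => Finset.sum_congr rfl fun b _ => ?_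
  simp only [conjMap, LinearMap.coe_mk, AddHom.coe_mk, Matrix.star_mulVec,
    ← Matrix.dotProduct_mulVec, Matrix.mulVec_mulVec, mul_assoc]

/-- A matrix-valued map as a map into the operators on a Hilbert space living in any universe. -/
noncomputable def operatorMap (φ : V →ₗ[ℂ] Matrix (Fin n) (Fin n) ℂ) :
    V →ₗ[ℂ] (EuclideanSpace ℂ (ULift.{v} (Fin n)) →L[ℂ] EuclideanSpace ℂ (ULift.{v} (Fin n))) :=
  (Matrix.toEuclideanCLM (𝕜 := ℂ) (n := ULift.{v} (Fin n))).toAlgEquiv.toLinearMap ∘ₗ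
    (Matrix.reindexLinearEquiv ℂ ℂ Equiv.ulift.symm Equiv.ulift.symm).toLinearMap ∘ₗ φ

lemma operatorMap_eq_one {φ : V →ₗ[ℂ] Matrix (Fin n) (Fin n) ℂ} {s : V} (h : φ s = 1) :
    operatorMap.{v} φ s = 1 := by
  change Matrix.toEuclideanCLM (𝕜 := ℂ) ((φ s).submatrix ULift.down ULift.down) = 1
  rw [h, Matrix.submatrix_one _ ULift.down_injective, map_one]

lemma ampForm_operatorMap (φ : V →ₗ[ℂ] Matrix (Fin n) (Fin n) ℂ) {k : ℕ}
    (x : Fin k → EuclideanSpace ℂ (ULift.{v} (Fin n))) (w : Matrix (Fin k) (Fin k) V) :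
    ampForm (operatorMap φ) x w = matrixForm φ (fun a i => x a (ULift.up i)) w := by
  rw [ampForm_apply, matrixForm]
  refine Finset.sum_congr rfl fun a _ => Finset.sum_congr rfl fun b _ => ?_
  change inner ℂ (x a) (Matrix.toEuclideanCLM (𝕜 := ℂ)
    ((φ (w a b)).submatrix ULift.down ULift.down) (x b)) = _
  rw [PiLp.inner_apply]
  simp only [Matrix.ofLp_toEuclideanCLM, dotProduct, Matrix.mulVec]
  rw [← Equiv.ulift.symm.sum_comp]
  refine Finset.sum_congr rfl fun i _ => ?_
  rw [← Equiv.ulift.symm.sum_comp]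
  simp [mul_comm]

end Functional

/-! ### Normalisation to a unital map. -/

section Main

variable {V : Type*} [AddCommGroup V] [Module ℂ V]

lemma posSemidef_of_forall_nonneg {n : ℕ} {M : Matrix (Fin n) (Fin n) ℂ}
    (hM : ∀ x : Fin n → ℂ, 0 ≤ star x ⬝ᵥ (M *ᵥ x)) : M.PosSemidef := by
  rw [← Matrix.isPositive_toEuclideanLin_iff, LinearMap.isPositive_iff_complex]
  intro x
  have h := Complex.le_def.1 (hM x.ofLp)
  have h2 : inner ℂ (Matrix.toEuclideanLin M x) x = star (star x.ofLp ⬝ᵥ (M *ᵥ x.ofLp)) := by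
    rw [EuclideanSpace.inner_eq_star_dotProduct, ← Matrix.star_dotProduct_star, star_star,
      dotProduct_comm]
    rfl
  rw [h2]
  simp only [Complex.ext_iff]
  simpa [eq_comm] using h.symm

/-- The value of `matrixMap F` at `e` is positive semidefinite with trace `F e_n = 1`, so the
perturbation adds exactly `ε 1`. -/
lemma posDef_tracePerturb [StarAddMonoid V] [StarModule ℂ V] {C : MatrixCones V} {e : V}
    (hS : IsOperatorSystem C e) {k n : ℕ} (hk : 1 ≤ k) {F : Matrix (Fin n) (Fin n) V →ₗ[ℂ] ℂ}
    (hF1 : F (ampUnit e n) = 1) (hF : ∀ v ∈ kMaxD C k n, 0 ≤ F v) {ε : ℝ} (hε : 0 < ε) :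
    (tracePerturb (matrixMap F) ε e).PosDef := by
  have htr : (matrixMap F e).trace = 1 := by
    have : ampUnit e n = ∑ i, Matrix.single i i e := by
      rw [Matrix.sum_single_eq_diagonal]
      rfl
    rw [← hF1, this, map_sum]
    rfl
  have hpos : ∀ x : Fin n → ℂ, 0 ≤ star x ⬝ᵥ (matrixMap F e *ᵥ x) := by
    intro x
    have h1 := matrixForm_matrixMap F (fun _ : Fin 1 => x) (Matrix.of fun _ _ => e)
    simp only [matrixForm, Finset.univ_unique, Finset.sum_singleton, Matrix.of_apply] at h1
    rw [h1]
    refine hF _ ?_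
    convert tensor_mem_kMaxD hS.matrixOrdering hk
      (Matrix.posSemidef_vecMulVec_star_self x) (unit_mem_cone_one hS) using 1
    ext i j
    simp [sandwich_apply, tensor, Matrix.vecMulVec_apply]
  rw [tracePerturb_apply, htr, mul_one]
  refine Matrix.PosDef.posSemidef_add (posSemidef_of_forall_nonneg hpos) ?_
  exact Matrix.PosDef.one.smul (by exact_mod_cast hε)

lemma exists_conjTranspose_mul_mul_eq_one {n : ℕ} {Q : Matrix (Fin n) (Fin n) ℂ}
    (hQ : Q.PosDef) : ∃ B R : Matrix (Fin n) (Fin n) ℂ, R * B = 1 ∧ Rᴴ * Q * R = 1 := by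
  open scoped MatrixOrder Matrix.Norms.L2Operator in
  obtain ⟨B, hB⟩ := CStarAlgebra.nonneg_iff_eq_star_mul_self.1 hQ.posSemidef.nonneg
  rw [Matrix.star_eq_conjTranspose] at hB
  have hu : IsUnit B := by
    have := (Matrix.isUnit_iff_isUnit_det _).1 hQ.isUnit
    rw [hB, Matrix.det_mul] at this
    exact (Matrix.isUnit_iff_isUnit_det _).2 (isUnit_of_mul_isUnit_right this)
  have hd := (Matrix.isUnit_iff_isUnit_det _).1 hu
  refine ⟨B, B⁻¹, Matrix.nonsing_inv_mul _ hd, ?_⟩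
  rw [hB, mul_assoc, mul_assoc, Matrix.mul_nonsing_inv _ hd, mul_one, ← Matrix.conjTranspose_mul,
    Matrix.mul_nonsing_inv _ hd, Matrix.conjTranspose_one]

/-- A self-adjoint matrix outside `C_n^{k-max}` is mapped to a non-positive matrix by some unital
`k`-positive map into the operators on a finite-dimensional Hilbert space. -/
lemma exists_isKPositive_not_nonneg [StarAddMonoid V] [StarModule ℂ V] {C : MatrixCones V} {e : V}
    (hS : IsOperatorSystem C e) {k n : ℕ} (hk : 1 ≤ k) {a : Matrix (Fin n) (Fin n) V}
    (ha : aᴴ = a) (hna : a ∉ kMax C e k n) :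
    ∃ φ : V →ₗ[ℂ] (EuclideanSpace ℂ (ULift.{v} (Fin n)) →L[ℂ]
      EuclideanSpace ℂ (ULift.{v} (Fin n))),
      φ e = 1 ∧ IsKPositive C (opCones _) k φ ∧ a.map φ ∉ opCones _ n := by
  obtain ⟨F, hF1, hF, hFa⟩ := exists_functional hS hk ha hna
  have hpos : ∀ w ∈ C k, ∀ x : Fin k → Fin n → ℂ, 0 ≤ matrixForm (matrixMap F) x w := by
    intro w hw x
    rw [matrixForm_matrixMap]
    simpa using hF _ (sandwich_mem_kMaxD hw (Matrix.of x)ᴴ)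
  let E : Fin n → Fin n → ℂ := fun i => Pi.single i 1
  let c : ℂ := ∑ i, ∑ p, matrixForm (matrixMap F) (fun a => Pi.single p (E a i)) a
  obtain ⟨ε, hε, hεc⟩ : ∃ ε : ℝ, 0 < ε ∧ (F a).re + ε * c.re < 0 := by
    -- Chosen so that `ε (|c.re| + 1) = -(F a).re`.
    refine ⟨-(F a).re / (|c.re| + 1), div_pos (by linarith) (by positivity), ?_⟩
    have h1 : -(F a).re / (|c.re| + 1) * (|c.re| + 1) = -(F a).re :=
      div_mul_cancel₀ _ (by positivity)
    have h2 : 0 < -(F a).re / (|c.re| + 1) := div_pos (by linarith) (by positivity)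
    nlinarith [le_abs_self c.re]
  obtain ⟨B, R, hRB, hR⟩ :=
    exists_conjTranspose_mul_mul_eq_one (posDef_tracePerturb hS hk hF1 hF hε)
  refine ⟨operatorMap (conjMap (tracePerturb (matrixMap F) ε) R), operatorMap_eq_one hR,
    fun w hw => map_mem_opCones_iff.2 fun x => ?_, fun h => ?_⟩
  · rw [ampForm_operatorMap, matrixForm_conjMap, matrixForm_tracePerturb]
    exact add_nonneg (hpos w hw _) (mul_nonneg (by exact_mod_cast hε.le)
      (Finset.sum_nonneg fun i _ => Finset.sum_nonneg fun p _ => hpos w hw _))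
  -- The test vectors `B E_i` cancel the congruence by `R`, leaving the form at the standard basis,
  -- whose value is `F a + ε c`.
  · have h1 := map_mem_opCones_iff.1 h
      fun i => WithLp.toLp 2 fun j : ULift.{v} (Fin n) => (B *ᵥ E i) j.down
    have h2 : (Matrix.of E : Matrix (Fin n) (Fin n) ℂ) = 1 := by
      ext i j
      simp [E, Matrix.one_apply, Pi.single_apply, eq_comm]
    have h3 : sandwich (1 : Matrix (Fin n) (Fin n) ℂ) a (1 : Matrix (Fin n) (Fin n) ℂ) = a := by
      ext i j
      simp [sandwich_apply, Matrix.one_apply]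
    rw [ampForm_operatorMap, matrixForm_conjMap] at h1
    change 0 ≤ matrixForm _ (fun i => R *ᵥ (B *ᵥ E i)) a at h1
    simp only [Matrix.mulVec_mulVec, hRB, Matrix.one_mulVec] at h1
    rw [matrixForm_tracePerturb, matrixForm_matrixMap] at h1
    have h4 : 0 ≤ F a + ε * c := by
      convert h1 using 3
      · rw [h2, Matrix.conjTranspose_one, h3]
    have h5 := (Complex.le_def.1 h4).1
    simp at h5
    linarith

end Main
end OpSys

/-! ### The equivalence, with reduction to self-adjoint matrices. -/

theorem mainTheorem10 {S : Type u} [AddCommGroup S] [Module ℂ S] [StarAddMonoid S]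
    [StarModule ℂ S] (C : OpSys.MatrixCones S) (e : S) (hS : OpSys.IsOperatorSystem C e)
    (k : ℕ) (hk : 1 ≤ k) (n : ℕ) (a : Matrix (Fin n) (Fin n) S) :
    a ∈ OpSys.kMax C e k n ↔
      ∀ (H : Type (max u v)) [NormedAddCommGroup H] [InnerProductSpace ℂ H] [CompleteSpace H]
        (φ : S →ₗ[ℂ] (H →L[ℂ] H)),
        φ e = 1 → OpSys.IsKPositive C (OpSys.opCones H) k φ → a.map φ ∈ OpSys.opCones H n := by
  open scoped ComplexOrder in
  open OpSys in
  constructor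
  · intro ha H _ _ _ φ he hφ
    exact map_mem_opCones_iff.2 fun x => ampForm_nonneg_of_mem_kMax he hφ ha x
  intro h
  have hsa : ∀ b : Matrix (Fin n) (Fin n) S, bᴴ = b →
      (∀ (H : Type (max u v)) [NormedAddCommGroup H] [InnerProductSpace ℂ H] [CompleteSpace H]
        (φ : S →ₗ[ℂ] (H →L[ℂ] H)), φ e = 1 → IsKPositive C (opCones H) k φ →
          b.map φ ∈ opCones H n) → b ∈ kMax C e k n := by
    intro b hb hpos
    by_contra hnb
    obtain ⟨φ, he, hφ, hn⟩ := exists_isKPositive_not_nonneg.{max u v} hS hk hb hnb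
    exact hn (hpos _ φ he hφ)
  refine hsa a ?_ h
  let x : Matrix (Fin n) (Fin n) S := (realPart a : Matrix (Fin n) (Fin n) S)
  let y : Matrix (Fin n) (Fin n) S := (imaginaryPart a : Matrix (Fin n) (Fin n) S)
  have hx : xᴴ = x := (realPart a).2
  have hy : yᴴ = y := (imaginaryPart a).2
  have hxy : x + Complex.I • y = a := realPart_add_I_smul_imaginaryPart a
  have hzero : ∀ (H : Type (max u v)) [NormedAddCommGroup H] [InnerProductSpace ℂ H]
      [CompleteSpace H] (φ : S →ₗ[ℂ] (H →L[ℂ] H)), φ e = 1 → IsKPositive C (opCones H) k φ →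
      ∀ z, ampForm φ z y = 0 := by
    intro H _ _ _ φ he hφ z
    have h1 := (Complex.le_def.1 (map_mem_opCones_iff.1 (h H φ he hφ) z)).2
    have h2 := ampForm_im_eq_zero hS hk he hφ hx z
    have h3 := ampForm_im_eq_zero hS hk he hφ hy z
    rw [← hxy, map_add, map_smul] at h1
    simp [h2] at h1
    exact Complex.ext h1.symm h3
  have hy1 : y ∈ kMax C e k n := hsa y hy fun H _ _ _ φ he hφ =>
    map_mem_opCones_iff.2 fun z => (hzero H φ he hφ z).ge
  have hy2 : -y ∈ kMax C e k n := hsa (-y) (by rw [Matrix.conjTranspose_neg, hy])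
    fun H _ _ _ φ he hφ => map_mem_opCones_iff.2 fun z => by
      rw [map_neg, hzero H φ he hφ z, neg_zero]
  have hy0 : y = 0 := (hS.matrixOrdering.properCone n).eq_zero y (kMax_subset hS k n hy1)
    (kMax_subset hS k n hy2)
  rw [← hxy, hy0, smul_zero, add_zero, hx]
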